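/- **Theorem 1.3.** Let $D$ be a connected link diagram with at least one crossing, together with a checkerboard coloring of its regions. Let $G$ be its Tait graph: its vertices are the black regions, its edges are the crossings of $D$, the edge of a crossing $c$ joining the two (possibly equal) black regions that are opposite at $c$; the edge is *positive* if the A-resolution of $c$ joins the two black corners at $c$, and *negative* if the B-resolution does. For a finite graph $\Gamma$ let $\chi_\Gamma(x,y)$ be its Tutte polynomial. For a state $\sigma$ of $D$ (a choice of the A- or B-resolution at each crossing) let $E_\sigma\subseteq E(G)$ be the set of the positive A-resolved and the negative B-resolved edges, and put $$\phi_D^\sigma(t)=\chi_{G|E_\sigma}(0,t)\cdot\chi_{G/E_\sigma}(t,0),$$ where $G|E_\sigma$ is the spanning subgraph of $G$ with edge set $E_\sigma$ and $G/E_\sigma$ is obtained from $G$ by contracting $E_\sigma$. Call $\sigma$ *adequate* if, in the state graph of $\sigma$ (the state circles obtained by resolving all crossings, with one segment for each crossing recording the resolution), no segment joins a state circle to itself. Then $$\chi_G(t,t)=\sum_{\sigma\ \text{adequate}}\phi_D^\sigma(t)\quad\text{in }\mathbb Z[t].$$ -/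

import Mathlib

open Polynomial

/-! ### Multigraphs: components, contraction, the Tutte polynomial -/

namespace Graph

variable {α : Type*} {β : Type*}

/-- Two points are equivalent when they are joined by a walk of `G`
(a point that is not a vertex is equivalent only to itself). -/
def componentSetoid (G : Graph α β) : Setoid α := Relation.EqvGen.setoid G.Adj

/-- The set of connected components of `G`: the classes of its vertices. -/
def componentSet (G : Graph α β) : Set (Quotient G.componentSetoid) :=
  Quotient.mk G.componentSetoid '' G.vertexSet

/-- The number `k(G)` of connected components of `G` (for `G` with finitely many vertices). -/
noncomputable def numComponents (G : Graph α β) : ℕ := G.componentSet.ncard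

/-- The graph `G / H` obtained by contracting the edges of `H`: its vertices are the connected
components of the spanning subgraph `G | H`, and its edges are the edges of `G` outside `H`.
In particular loops in `H` are deleted. The graph `G | H` itself is `G.restrict H`, and
`G - e` is `G.deleteEdges {e}`. -/
def contract (G : Graph α β) (H : Set β) :
    Graph (Quotient (G.restrict H).componentSetoid) β :=
  (G.map (Quotient.mk (G.restrict H).componentSetoid)).deleteEdges H

/-- A bridge is an edge whose deletion increases the number of connected components. -/
def IsBridge (G : Graph α β) (e : β) : Prop :=
  e ∈ G.edgeSet ∧ G.numComponents < (G.deleteEdges {e}).numComponents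

/-- The Tutte polynomial `χ_G(x, y)` of a finite graph, where `x = X 0` and `y = X 1`, as the
rank generating polynomial
`∑_{A ⊆ E(G)} (x - 1) ^ (k(G|A) - k(G)) * (y - 1) ^ (|A| + k(G|A) - |V(G)|)`.
Neither subtraction truncates. The theorems `tutte_of_edgeSet_eq_empty`, `tutte_of_isBridge`,
`tutte_of_isLoopAt` and `tutte_of_not_isBridge` below prove the recursive description
by deletion and contraction, which determines the polynomial. -/
noncomputable def tutte [Finite β] (G : Graph α β) : MvPolynomial (Fin 2) ℤ :=
  ∑ A ∈ (Set.toFinite G.edgeSet).toFinset.powerset,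
    (MvPolynomial.X 0 - 1) ^ ((G.restrict (A : Set β)).numComponents - G.numComponents) *
    (MvPolynomial.X 1 - 1) ^
      (A.card + (G.restrict (A : Set β)).numComponents - G.vertexSet.ncard)

/-- The value `χ_G(p, q)` of the Tutte polynomial at two polynomials `p`, `q` in one
variable `t`. -/
noncomputable def tutteEval [Finite β] (G : Graph α β) (p q : ℤ[X]) : ℤ[X] :=
  MvPolynomial.aeval ![p, q] G.tutte

/-- The symmetrized Tutte polynomial `χ_G(t, t)`. -/
noncomputable def symmTutte [Finite β] (G : Graph α β) : ℤ[X] := G.tutteEval X X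

/-! #### The deletion-contraction recursion -/

theorem ncard_image_congr {γ δ : Type*} (f : α → γ) (g : α → δ) (S : Set α)
    (h : ∀ a b, f a = f b ↔ g a = g b) : (f '' S).ncard = (g '' S).ncard := by
  classical
  have hf : ∀ a, ∃ d, ∀ b, f b = f a → g b = d := fun a => ⟨g a, fun b hb => (h b a).1 hb⟩
  refine Set.ncard_congr (fun c _ => if hc : ∃ a, f a = c then g hc.choose else g (Classical.choice
    (by rename_i hcS; obtain ⟨a, _, _⟩ := hcS; exact ⟨a⟩))) ?_ ?_ ?_
  · rintro _ ⟨a, ha, rfl⟩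
    have hc : ∃ a', f a' = f a := ⟨a, rfl⟩
    rw [dif_pos hc]
    exact ⟨a, ha, ((h _ _).1 hc.choose_spec).symm⟩
  · rintro _ _ ⟨a, ha, rfl⟩ ⟨b, hb, rfl⟩ hab
    have hc : ∃ a', f a' = f a := ⟨a, rfl⟩
    have hd : ∃ a', f a' = f b := ⟨b, rfl⟩
    rw [dif_pos hc, dif_pos hd] at hab
    rw [← hc.choose_spec, ← hd.choose_spec]
    exact (h _ _).2 hab
  · rintro _ ⟨a, ha, rfl⟩
    have hc : ∃ a', f a' = f a := ⟨a, rfl⟩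
    refine ⟨f a, ⟨a, ha, rfl⟩, ?_⟩
    rw [dif_pos hc]
    exact (h _ _).1 hc.choose_spec

theorem mk_eq_iff (G : Graph α β) (a b : α) :
    Quotient.mk G.componentSetoid a = Quotient.mk G.componentSetoid b ↔
      Relation.EqvGen G.Adj a b := Quotient.eq

theorem eqvGen_of_le {γ : Type*} {r : α → α → Prop} (f : α → γ)
    (h : ∀ a b, r a b → f a = f b) {a b : α} (hab : Relation.EqvGen r a b) : f a = f b := by
  induction hab with
  | rel _ _ h' => exact h _ _ h'
  | refl => rfl
  | symm _ _ _ ih => exact ih.symm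
  | trans _ _ _ _ _ ih1 ih2 => exact ih1.trans ih2

theorem numComponents_contract_restrict (G : Graph α β) (H A : Set β) :
    ((G.contract H).restrict A).numComponents = (G.restrict (A ∪ H)).numComponents := by
  have hV : ((G.contract H).restrict A).componentSet =
      (fun a => Quotient.mk ((G.contract H).restrict A).componentSetoid
        (Quotient.mk (G.restrict H).componentSetoid a)) '' G.vertexSet := by
    simp only [componentSet, contract]
    ext c
    simp only [Set.mem_image]
    constructor
    · rintro ⟨_, ⟨a, ha, rfl⟩, rfl⟩
      exact ⟨a, ha, rfl⟩
    · rintro ⟨a, ha, rfl⟩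
      exact ⟨_, ⟨a, ha, rfl⟩, rfl⟩
  unfold numComponents
  rw [hV]
  refine ncard_image_congr _ _ _ fun a b => ⟨fun h => ?_, fun h => ?_⟩
  · have key : ∀ x y, (Quotient.mk (G.restrict H).componentSetoid x) =
        (Quotient.mk (G.restrict H).componentSetoid y) →
        Quotient.mk (G.restrict (A ∪ H)).componentSetoid x =
        Quotient.mk (G.restrict (A ∪ H)).componentSetoid y := by
      intro x y hxy
      rw [mk_eq_iff] at hxy
      refine eqvGen_of_le _ ?_ hxy
      rintro p q ⟨e, he, hl⟩
      rw [mk_eq_iff]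
      exact .rel _ _ ⟨e, Or.inr he, hl⟩
    rw [mk_eq_iff] at h
    have := eqvGen_of_le (Quotient.lift (Quotient.mk (G.restrict (A ∪ H)).componentSetoid)
      (fun x y hxy => key x y (Quotient.sound hxy))) ?_ h
    · exact this
    · rintro _ _ ⟨e, he, ⟨p, q, hl, rfl, rfl⟩, heH⟩
      exact (mk_eq_iff _ _ _).2 (.rel _ _ ⟨e, Or.inl he, hl⟩)
  · rw [mk_eq_iff] at h
    refine eqvGen_of_le (fun a => Quotient.mk ((G.contract H).restrict A).componentSetoid
        (Quotient.mk (G.restrict H).componentSetoid a)) ?_ h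
    rintro p q ⟨e, he, hl⟩
    by_cases heH : e ∈ H
    · exact congrArg _ ((mk_eq_iff _ _ _).2 (.rel _ _ ⟨e, heH, hl⟩))
    · exact (mk_eq_iff _ _ _).2
        (.rel _ _ ⟨e, he.resolve_right heH, ⟨p, q, hl, rfl, rfl⟩, heH⟩)

theorem numComponents_restrict_insert_of_eqv (G : Graph α β) {e : β} {u v : α} (A : Set β)
    (hl : G.IsLink e u v) (h : Relation.EqvGen (G.restrict A).Adj u v) :
    (G.restrict (insert e A)).numComponents = (G.restrict A).numComponents := by
  refine ncard_image_congr _ _ _ fun a b => ⟨fun hab => ?_, fun hab => ?_⟩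
  · rw [mk_eq_iff] at hab
    refine eqvGen_of_le _ ?_ hab
    rintro p q ⟨f, hf, hfl⟩
    rw [mk_eq_iff]
    obtain rfl | hf := hf
    · obtain ⟨rfl, rfl⟩ | ⟨rfl, rfl⟩ := hl.eq_and_eq_or_eq_and_eq hfl
      · exact h
      · exact h.symm _ _
    · exact .rel _ _ ⟨f, hf, hfl⟩
  · rw [mk_eq_iff] at hab
    refine eqvGen_of_le _ ?_ hab
    rintro p q ⟨f, hf, hfl⟩
    exact (mk_eq_iff _ _ _).2 (.rel _ _ ⟨f, Or.inr hf, hfl⟩)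

theorem numComponents_restrict_insert_of_not_eqv [Finite α] (G : Graph α β) {e : β} {u v : α}
    (A : Set β) (hl : G.IsLink e u v) (h : ¬ Relation.EqvGen (G.restrict A).Adj u v) :
    (G.restrict (insert e A)).numComponents + 1 = (G.restrict A).numComponents := by
  classical
  let m := Quotient.mk (G.restrict A).componentSetoid
  let m' := Quotient.mk (G.restrict (insert e A)).componentSetoid
  have huv : m u ≠ m v := fun h' => h ((mk_eq_iff _ _ _).1 h')
  have hmono : ∀ a b, m a = m b → m' a = m' b := by
    intro a b hab
    refine eqvGen_of_le _ ?_ ((mk_eq_iff _ _ _).1 hab)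
    rintro p q ⟨f, hf, hfl⟩
    exact (mk_eq_iff _ _ _).2 (.rel _ _ ⟨f, Or.inr hf, hfl⟩)
  have huv' : m' u = m' v := (mk_eq_iff _ _ _).2 (.rel _ _ ⟨e, Or.inl rfl, hl⟩)
  let g : α → Quotient (G.restrict A).componentSetoid := fun a => if m a = m v then m u else m a
  have hg : ∀ a b, m' a = m' b ↔ g a = g b := by
    intro a b
    constructor
    · intro hab
      refine eqvGen_of_le g ?_ ((mk_eq_iff _ _ _).1 hab)
      rintro p q ⟨f, hf, hfl⟩
      obtain rfl | hf := hf
      · obtain ⟨rfl, rfl⟩ | ⟨rfl, rfl⟩ := hl.eq_and_eq_or_eq_and_eq hfl <;> simp [g]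
      · have : m p = m q := (mk_eq_iff _ _ _).2 (.rel _ _ ⟨f, hf, hfl⟩)
        simp [g, this]
    · intro hab
      simp only [g] at hab
      split_ifs at hab with h1 h2 h2
      · exact hmono _ _ (h1.trans h2.symm)
      · exact (hmono _ _ h1).trans (huv'.symm.trans (hmono _ _ hab))
      · exact (hmono _ _ hab).trans (huv'.trans (hmono _ _ h2).symm)
      · exact hmono _ _ hab
  have h1 : (G.restrict (insert e A)).numComponents = (g '' G.vertexSet).ncard :=
    ncard_image_congr m' g _ hg
  have h2 : g '' G.vertexSet = (m '' G.vertexSet) \ {m v} := by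
    ext c
    constructor
    · rintro ⟨a, ha, rfl⟩
      by_cases h1 : m a = m v
      · simp only [g, h1, if_true]
        exact ⟨⟨u, hl.left_mem, rfl⟩, huv⟩
      · simp only [g, h1, if_false]
        exact ⟨⟨a, ha, rfl⟩, h1⟩
    · rintro ⟨⟨a, ha, rfl⟩, h1⟩
      exact ⟨a, ha, if_neg h1⟩
  rw [h1, h2]
  exact Set.ncard_sdiff_singleton_add_one ⟨v, hl.right_mem, rfl⟩ (Set.toFinite _)

theorem numComponents_of_edgeSet_eq_empty (G : Graph α β) (h : G.edgeSet = ∅) :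
    G.numComponents = G.vertexSet.ncard := by
  have : (id '' G.vertexSet).ncard = G.vertexSet.ncard := by simp
  rw [← this]
  refine ncard_image_congr _ _ _ fun a b => ⟨fun hab => ?_, fun hab => ?_⟩
  · rw [mk_eq_iff] at hab
    refine eqvGen_of_le _ ?_ hab
    rintro p q ⟨f, hf⟩
    exact absurd hf.edge_mem (by simp [h])
  · exact congrArg _ hab

theorem eqvGen_mono (G : Graph α β) {A B : Set β} (h : A ⊆ B) {u v : α}
    (huv : Relation.EqvGen (G.restrict A).Adj u v) : Relation.EqvGen (G.restrict B).Adj u v :=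
  huv.mono fun _ _ ⟨e, he, hl⟩ => ⟨e, h he, hl⟩

/-- Adding one edge changes the number of components by zero or by minus one. -/
theorem numComponents_restrict_insert_le [Finite α] (G : Graph α β) (e : β) (A : Set β) :
    (G.restrict (insert e A)).numComponents ≤ (G.restrict A).numComponents ∧
    (G.restrict A).numComponents ≤ (G.restrict (insert e A)).numComponents + 1 := by
  by_cases he : e ∈ G.edgeSet
  · obtain ⟨u, v, hl⟩ := exists_isLink_of_mem_edgeSet he
    by_cases h : Relation.EqvGen (G.restrict A).Adj u v
    · have := numComponents_restrict_insert_of_eqv G A hl h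
      omega
    · have := numComponents_restrict_insert_of_not_eqv G A hl h
      omega
  · have : G.restrict (insert e A) = G.restrict A := by
      rw [← G.restrict_edgeSet_inter, Set.inter_insert_of_notMem he, G.restrict_edgeSet_inter]
    simp [this]

theorem ncard_vertexSet_le [Finite α] (G : Graph α β) (A : Finset β) :
    G.vertexSet.ncard ≤ A.card + (G.restrict (A : Set β)).numComponents := by
  classical
  induction A using Finset.induction_on with
  | empty =>
    rw [numComponents_of_edgeSet_eq_empty _ (by simp)]
    simp
  | insert e A he ih =>
    rw [Finset.card_insert_of_notMem he, Finset.coe_insert]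
    have := (numComponents_restrict_insert_le G e A).2
    omega

theorem numComponents_restrict_anti [Finite α] (G : Graph α β) (A : Set β) (B : Finset β) :
    (G.restrict (A ∪ B)).numComponents ≤ (G.restrict A).numComponents := by
  classical
  induction B using Finset.induction_on with
  | empty => simp
  | insert e B he ih =>
    rw [Finset.coe_insert, Set.union_insert]
    exact (numComponents_restrict_insert_le G e _).1.trans ih

theorem numComponents_le_restrict [Finite α] [Finite β] (G : Graph α β) (A : Set β) :
    G.numComponents ≤ (G.restrict A).numComponents := by
  have h := numComponents_restrict_anti G A (Set.toFinite G.edgeSet).toFinset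
  rw [Set.Finite.coe_toFinset, ← restrict_edgeSet_inter, Set.inter_eq_left.2 (by simp),
    restrict_self] at h
  exact h

theorem deleteEdges_restrict (G : Graph α β) {e : β} {A : Set β} (he : e ∉ A) :
    (G.deleteEdges {e}).restrict A = G.restrict A := by
  rw [← restrict_edgeSet_sdiff_eq_deleteEdges, restrict_restrict]
  rw [← G.restrict_edgeSet_inter A, ← G.restrict_edgeSet_inter (_ ∩ _)]
  congr 1
  ext x
  simp only [Set.mem_inter_iff, Set.mem_sdiff, Set.mem_singleton_iff]
  constructor
  · tauto
  · rintro ⟨h1, h2⟩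
    exact ⟨h1, ⟨h1, fun h => he (h ▸ h2)⟩, h2⟩

theorem tutte_of_edgeSet_eq_empty [Finite β] (G : Graph α β) (h : G.edgeSet = ∅) :
    G.tutte = 1 := by
  have h1 : (Set.toFinite G.edgeSet).toFinset = ∅ := by simp [h]
  have h2 : (G.restrict ∅).numComponents = G.vertexSet.ncard :=
    numComponents_of_edgeSet_eq_empty _ (by simp)
  have h3 := numComponents_of_edgeSet_eq_empty G h
  simp [tutte, h1, h2, h3]

theorem tutte_eq_add [Finite β] [DecidableEq β] (G : Graph α β) {e : β} (he : e ∈ G.edgeSet) :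
    G.tutte =
      ∑ A ∈ (Set.toFinite (G.edgeSet \ {e})).toFinset.powerset,
        (MvPolynomial.X 0 - 1) ^ ((G.restrict (A : Set β)).numComponents - G.numComponents) *
        (MvPolynomial.X 1 - 1) ^
          (A.card + (G.restrict (A : Set β)).numComponents - G.vertexSet.ncard) +
      ∑ A ∈ (Set.toFinite (G.edgeSet \ {e})).toFinset.powerset,
        (MvPolynomial.X 0 - 1) ^
          ((G.restrict (insert e (A : Set β))).numComponents - G.numComponents) *
        (MvPolynomial.X 1 - 1) ^
          (A.card + 1 + (G.restrict (insert e (A : Set β))).numComponents -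
            G.vertexSet.ncard) := by
  have h1 : (Set.toFinite G.edgeSet).toFinset =
      insert e (Set.toFinite (G.edgeSet \ {e})).toFinset := by
    ext x
    by_cases hx : x = e <;> simp [hx, he]
  have h2 : e ∉ (Set.toFinite (G.edgeSet \ {e})).toFinset := by simp
  rw [tutte, h1, Finset.sum_powerset_insert h2]
  congr 1
  refine Finset.sum_congr rfl fun A hA => ?_
  have hA' : e ∉ A := fun h => h2 (Finset.mem_powerset.1 hA h)
  rw [Finset.coe_insert, Finset.card_insert_of_notMem hA']

theorem notMem_of_mem_powerset [Finite β] {G : Graph α β} {e : β} {A : Finset β}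
    (hA : A ∈ (Set.toFinite (G.edgeSet \ {e})).toFinset.powerset) : e ∉ (A : Set β) :=
  fun h => by simpa using Finset.mem_powerset.1 hA h

theorem numComponents_restrict_edgeSet_diff (G : Graph α β) (e : β) :
    (G.restrict (G.edgeSet \ {e})).numComponents = (G.deleteEdges {e}).numComponents := by
  rw [restrict_edgeSet_sdiff_eq_deleteEdges]

theorem restrict_insert_edgeSet_diff (G : Graph α β) {e : β} (he : e ∈ G.edgeSet) :
    G.restrict (insert e (G.edgeSet \ {e})) = G := by
  rw [Set.insert_sdiff_singleton, Set.insert_eq_of_mem he, restrict_self]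

/-- For an edge `e` that is not a loop, the terms of the subsets containing `e` sum
to the Tutte polynomial of `G / e`. -/
theorem tutte_contract_eq [Finite α] [Finite β] (G : Graph α β) {e : β} {u v : α}
    (hl : G.IsLink e u v) (huv : u ≠ v) :
    (G.contract {e}).tutte =
      ∑ A ∈ (Set.toFinite (G.edgeSet \ {e})).toFinset.powerset,
        (MvPolynomial.X 0 - 1) ^
          ((G.restrict (insert e (A : Set β))).numComponents - G.numComponents) *
        (MvPolynomial.X 1 - 1) ^
          (A.card + 1 + (G.restrict (insert e (A : Set β))).numComponents -
            G.vertexSet.ncard) := by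
  have hV : (G.contract {e}).vertexSet.ncard + 1 = G.vertexSet.ncard := by
    have h1 : (G.contract {e}).vertexSet.ncard = (G.restrict {e}).numComponents := rfl
    have h2 := numComponents_restrict_insert_of_not_eqv G ∅ hl (fun h => huv
      (eqvGen_of_le id (by rintro p q ⟨f, hf, -⟩; exact hf.elim) h))
    rw [← Set.singleton_def] at h2
    rw [h1, h2]
    exact numComponents_of_edgeSet_eq_empty _ (by simp)
  have hk : (G.contract {e}).numComponents = G.numComponents := by
    have h := numComponents_contract_restrict G {e} (G.contract {e}).edgeSet
    rw [restrict_self] at h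
    rw [h, Set.union_singleton]
    exact congrArg _ (restrict_insert_edgeSet_diff G hl.edge_mem)
  unfold tutte
  refine Finset.sum_congr rfl fun A _ => ?_
  rw [numComponents_contract_restrict, hk, Set.union_singleton, ← hV]
  congr 2
  omega

theorem tutte_deleteEdges_eq [Finite β] (G : Graph α β) (e : β) :
    (G.deleteEdges {e}).tutte =
      ∑ A ∈ (Set.toFinite (G.edgeSet \ {e})).toFinset.powerset,
        (MvPolynomial.X 0 - 1) ^
          ((G.restrict (A : Set β)).numComponents - (G.deleteEdges {e}).numComponents) *
        (MvPolynomial.X 1 - 1) ^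
          (A.card + (G.restrict (A : Set β)).numComponents - G.vertexSet.ncard) := by
  unfold tutte
  refine Finset.sum_congr rfl fun A hA => ?_
  rw [deleteEdges_restrict _ (notMem_of_mem_powerset hA)]
  rfl

/-- `χ_G = y * χ_{G - e}` for a loop `e`. -/
theorem tutte_of_isLoopAt [Finite α] [Finite β] (G : Graph α β) {e : β} {v : α}
    (h : G.IsLoopAt e v) :
    G.tutte = MvPolynomial.X 1 * (G.deleteEdges {e}).tutte := by
  classical
  have hk : ∀ A : Set β, (G.restrict (insert e A)).numComponents =
      (G.restrict A).numComponents := fun A =>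
    numComponents_restrict_insert_of_eqv G A h (.refl _)
  have hE : (G.deleteEdges {e}).numComponents = G.numComponents := by
    rw [← numComponents_restrict_edgeSet_diff, ← hk, restrict_insert_edgeSet_diff G h.edge_mem]
  rw [tutte_eq_add G h.edge_mem, tutte_deleteEdges_eq, Finset.mul_sum, ← Finset.sum_add_distrib]
  refine Finset.sum_congr rfl fun A _ => ?_
  have h1 := ncard_vertexSet_le G A
  rw [hk, hE, show A.card + 1 + (G.restrict (A : Set β)).numComponents - G.vertexSet.ncard =
    A.card + (G.restrict (A : Set β)).numComponents - G.vertexSet.ncard + 1 by omega]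
  ring

/-- `χ_G = x * χ_{G / e}` for a bridge `e`. -/
theorem tutte_of_isBridge [Finite α] [Finite β] (G : Graph α β) {e : β} (h : G.IsBridge e) :
    G.tutte = MvPolynomial.X 0 * (G.contract {e}).tutte := by
  classical
  obtain ⟨he, hlt⟩ := h
  obtain ⟨u, v, hl⟩ := exists_isLink_of_mem_edgeSet he
  rw [← numComponents_restrict_edgeSet_diff] at hlt
  have hE : ¬ Relation.EqvGen (G.restrict (G.edgeSet \ {e})).Adj u v := by
    intro h
    have := numComponents_restrict_insert_of_eqv G _ hl h
    rw [restrict_insert_edgeSet_diff G he] at this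
    omega
  have huv : u ≠ v := by
    rintro rfl
    exact hE (.refl _)
  rw [tutte_eq_add G he, tutte_contract_eq G hl huv, Finset.mul_sum, ← Finset.sum_add_distrib]
  refine Finset.sum_congr rfl fun A hA => ?_
  have hsub : (A : Set β) ⊆ G.edgeSet \ {e} := by
    intro x hx
    simpa using Finset.mem_powerset.1 hA hx
  have h1 := numComponents_restrict_insert_of_not_eqv G (A : Set β) hl
    (fun h => hE (eqvGen_mono G hsub h))
  have h2 := numComponents_le_restrict G (insert e (A : Set β))
  rw [← h1, show (G.restrict (insert e (A : Set β))).numComponents + 1 - G.numComponents =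
      (G.restrict (insert e (A : Set β))).numComponents - G.numComponents + 1 by omega,
    show A.card + ((G.restrict (insert e (A : Set β))).numComponents + 1) =
      A.card + 1 + (G.restrict (insert e (A : Set β))).numComponents by omega]
  ring

/-- `χ_G = χ_{G / e} + χ_{G - e}` for an edge `e` that is neither a bridge nor a loop. -/
theorem tutte_of_not_isBridge [Finite α] [Finite β] (G : Graph α β) {e : β}
    (he : e ∈ G.edgeSet) (h1 : ¬ G.IsBridge e) (h2 : ∀ v, ¬ G.IsLoopAt e v) :
    G.tutte = (G.contract {e}).tutte + (G.deleteEdges {e}).tutte := by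
  classical
  obtain ⟨u, v, hl⟩ := exists_isLink_of_mem_edgeSet he
  have huv : u ≠ v := by
    rintro rfl
    exact h2 _ hl
  have hE : (G.deleteEdges {e}).numComponents = G.numComponents := by
    have h3 := numComponents_le_restrict G (G.edgeSet \ {e})
    rw [numComponents_restrict_edgeSet_diff] at h3
    have h4 : ¬ G.numComponents < (G.deleteEdges {e}).numComponents := fun h => h1 ⟨he, h⟩
    omega
  rw [tutte_eq_add G he, tutte_contract_eq G hl huv, tutte_deleteEdges_eq, hE, add_comm]

end Graph

/-! ### Link diagrams -/

/-- The permutation that walks around a face of a projection graph. Here `C` is the set of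
crossings, the pairs `(c, 0), …, (c, 3)` are the four ends of strands at the crossing `c` in
counterclockwise order, and `glue` sends an end to the other end of the same edge.
A pair `(c, i)` also names the corner at `c` between the ends `(c, i)` and `(c, i + 1)`.
Leaving `c` through `(c, i)`, this corner is on the left; arriving through `(d, j) = glue (c, i)`,
the corner on the left is `(d, j - 1)`. So the orbits are the faces. -/
def walkFace {C : Type*} (glue : Equiv.Perm (C × Fin 4)) : Equiv.Perm (C × Fin 4) :=
  glue.trans ((Equiv.refl C).prodCongr (Equiv.subRight (1 : Fin 4)))

/-- A connected link diagram with at least one crossing, up to planar isotopy, with crossing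
set `C`. Four ends of strands leave every crossing `c`; they are called
`(c, 0), (c, 1), (c, 2), (c, 3)` in counterclockwise order, where `(c, 0)` and `(c, 2)` belong to
the strand that passes under and `(c, 1)` and `(c, 3)` to the strand that passes over.
The permutation `glue` says which two ends are the two ends of an edge of the projection graph.
An abstract gluing is drawn on a closed oriented surface; the diagram is planar exactly when it is
connected and Euler's formula `V - E + F = 2` holds, the faces being the orbits of the
permutation `walkFace glue`. (A diagram in the plane and the same diagram on the sphere have the
same regions, Tait graphs and states.)
A connected diagram with a crossing has no crossingless component, so its edges all
arise in this way. -/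
structure ConnectedLinkDiagram (C : Type*) where
  /-- The end at the other side of the edge that leaves through a given end. -/
  glue : Equiv.Perm (C × Fin 4)
  glue_glue : ∀ x, glue (glue x) = x
  glue_ne : ∀ x, glue x ≠ x
  /-- The projection graph is connected (in particular it has a vertex). -/
  connected : (SimpleGraph.fromRel fun c d : C => ∃ i, (glue (c, i)).1 = d).Connected
  /-- Euler's formula for the projection graph: vertices are crossings, edges are orbits of `glue`,
  faces are orbits of `walkFace glue`. -/
  planar : (Nat.card C : ℤ) - Nat.card (Quotient (Equiv.Perm.SameCycle.setoid glue)) +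
    Nat.card (Quotient (Equiv.Perm.SameCycle.setoid (walkFace glue))) = 2

/-- The two ways of resolving a crossing. -/
inductive Resolution : Type
  | A
  | B
  deriving DecidableEq

instance : Fintype Resolution where
  elems := {.A, .B}
  complete r := by cases r <;> simp

namespace ConnectedLinkDiagram

variable {C : Type*} (D : ConnectedLinkDiagram C)

/-- The regions of the diagram, i.e. the faces of its projection graph. -/
def Region : Type _ := Quotient (Equiv.Perm.SameCycle.setoid (walkFace D.glue))

/-- The region that contains the corner between the ends `(c, i)` and `(c, i + 1)`. -/
def region (c : C) (i : Fin 4) : D.Region :=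
  Quotient.mk (Equiv.Perm.SameCycle.setoid (walkFace D.glue)) (c, i)

/-- A checkerboard coloring: each region is black or white, and around each crossing
the colors of the four corners alternate. -/
structure Coloring where
  IsBlack : D.Region → Prop
  alternating : ∀ c i, IsBlack (D.region c (i + 1)) ↔ ¬ IsBlack (D.region c i)

variable {D} in
theorem Coloring.add_two (κ : D.Coloring) (c : C) (i : Fin 4) :
    κ.IsBlack (D.region c (i + 2)) ↔ κ.IsBlack (D.region c i) := by
  have h1 := κ.alternating c i
  have h2 := κ.alternating c (i + 1)
  rw [add_assoc, show (1 : Fin 4) + 1 = 2 from rfl] at h2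
  tauto

variable {D} in
/-- The Tait graph (without its signs): the vertices are the black regions, the edges are the
crossings, and the edge `c` joins the regions of the two opposite black corners at `c`. -/
def Coloring.taitGraph (κ : D.Coloring) : Graph D.Region C where
  vertexSet := {r | κ.IsBlack r}
  IsLink c r s := ∃ i, κ.IsBlack (D.region c i) ∧ r = D.region c i ∧ s = D.region c (i + 2)
  isLink_symm := by
    rintro c -
    refine ⟨?_⟩
    rintro _ _ ⟨i, hi, rfl, rfl⟩
    refine ⟨i + 2, (κ.add_two c i).2 hi, rfl, ?_⟩
    rw [add_assoc, show (2 : Fin 4) + 2 = 0 from rfl, add_zero]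
  eq_or_eq_of_isLink_of_isLink := by
    rintro c _ _ _ _ ⟨i, hi, rfl, rfl⟩ ⟨j, hj, rfl, rfl⟩
    have h1 := κ.alternating c i
    have h2 := κ.alternating c j
    have h : j = i ∨ j = i + 1 ∨ i = j + 1 ∨ i = j + 2 := by
      have : ∀ i j : Fin 4, j = i ∨ j = i + 1 ∨ i = j + 1 ∨ i = j + 2 := by decide
      exact this i j
    rcases h with rfl | rfl | rfl | rfl
    · exact Or.inl rfl
    · exact absurd hi (h1.1 hj)
    · exact absurd hj (h2.1 hi)
    · exact Or.inr rfl
  left_mem_of_isLink := by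
    rintro c _ _ ⟨i, hi, rfl, rfl⟩
    exact hi

variable {D} in
/-- The sign of the edge `c` of the Tait graph. The corners `(c, 1)` and `(c, 3)` are
those swept out when the over-strand turns counterclockwise, and the A-resolution joins them.
The edge is positive when these corners are black, i.e. when the A-resolution joins the black
corners, and negative when the B-resolution joins the black corners. -/
def Coloring.IsPositive (κ : D.Coloring) (c : C) : Prop := κ.IsBlack (D.region c 1)

end ConnectedLinkDiagram

/-! ### States and adequacy -/

/-- The arcs that replace a crossing: each end is joined to another one. The A-resolution
joins `0` with `1` and `2` with `3`, so it connects the corners `1` and `3`; the B-resolution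
joins `1` with `2` and `3` with `0`, so it connects the corners `0` and `2`. -/
def Resolution.arc : Resolution → Fin 4 → Fin 4
  | .A => ![1, 0, 3, 2]
  | .B => ![3, 2, 1, 0]

namespace ConnectedLinkDiagram

/-- A state is a choice of a resolution at each crossing. -/
abbrev State {C : Type*} (_ : ConnectedLinkDiagram C) : Type _ := C → Resolution

variable {C : Type*} (D : ConnectedLinkDiagram C)

/-- Two ends lie on the same state circle if one can pass from one to the other along edges
of the diagram and arcs of the resolved crossings. -/
def circleSetoid (σ : D.State) : Setoid (C × Fin 4) :=
  Relation.EqvGen.setoid fun x y => y = D.glue x ∨ y = (x.1, (σ x.1).arc x.2)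

/-- The state circles of the state graph `H_σ`. -/
def StateCircle (σ : D.State) : Type _ := Quotient (D.circleSetoid σ)

/-- The state circle through an end. -/
def stateCircle (σ : D.State) (c : C) (i : Fin 4) : D.StateCircle σ :=
  Quotient.mk (D.circleSetoid σ) (c, i)

/-- The state `σ` is adequate if no state segment joins a state circle to itself. The
state segment at `c` joins the two arcs at `c`, one of which contains the end `(c, 0)` and
the other one the end `(c, 2)`. -/
def IsAdequate (σ : D.State) : Prop :=
  ∀ c, D.stateCircle σ c 0 ≠ D.stateCircle σ c 2

variable {D}

/-- The set `E_σ` of the edges of the Tait graph that are positive and A-resolved, or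
negative and B-resolved. -/
def Coloring.edgesOf (κ : D.Coloring) (σ : D.State) : Set C :=
  {c | κ.IsPositive c ∧ σ c = .A} ∪ {c | ¬ κ.IsPositive c ∧ σ c = .B}

/-- The polynomial `φ_D^σ(t) = χ_{G|E_σ}(0, t) * χ_{G/E_σ}(t, 0)`, where `G` is the
Tait graph. -/
noncomputable def Coloring.phi [Finite C] (κ : D.Coloring) (σ : D.State) : ℤ[X] :=
  (κ.taitGraph.restrict (κ.edgesOf σ)).tutteEval 0 X *
    (κ.taitGraph.contract (κ.edgesOf σ)).tutteEval X 0

end ConnectedLinkDiagram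

/-! The starting point is the convolution formula for Tutte polynomials: χ_G(p, q) is the sum over
all A ⊆ E(G) of χ_{G|A}(0, q) · χ_{G/A}(p, 0) (`tutteEval_convolution`). It holds for every finite
graph. Since σ ↦ E_σ is a bijection from states to edge sets, at p = q = t it expresses χ_G(t, t) as
the sum of φ over all states. It remains to see that an inadequate state contributes zero.

Suppose the segment at c joins a state circle to itself. The black regions met along a state circle
stay in one component of G|E_σ (`eqvGen_blackRegion`), so the ends of c are connected there. If c ∉
E_σ, then c is a loop of G/E_σ and the second factor vanishes.

If c ∈ E_σ, the same argument applies to the white regions, that is, to the dual graph G* with the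
complementary edge set: the ends of the dual edge are connected in G*|E_σᶜ. Planar duality turns
this into the statement that c is a bridge of G|E_σ, so the first factor vanishes.

Duality is used in the form that k(G|A) - k(G*|Aᶜ) + |A| does not depend on A (`nullityDefect_eq`).
Inserting an edge cannot decrease this number, because at least one resolution of a crossing gives a
segment from a circle to itself. Euler's formula makes the values at the empty and the full edge set
equal, so the number is constant. -/

namespace Graph

variable {α : Type*} {β : Type*}

/-! ### Rank generating sums of restrictions and contractions -/

theorem tutteEval_eq_sum [Finite β] (G : Graph α β) (p q : ℤ[X]) :
    G.tutteEval p q = ∑ A ∈ (Set.toFinite G.edgeSet).toFinset.powerset,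
      (p - 1) ^ ((G.restrict (A : Set β)).numComponents - G.numComponents) *
      (q - 1) ^ (A.card + (G.restrict (A : Set β)).numComponents - G.vertexSet.ncard) := by
  simp [tutteEval, tutte, map_sum]

theorem contract_edgeSet (G : Graph α β) (H : Set β) :
    (G.contract H).edgeSet = G.edgeSet \ H := by
  simp [contract]

theorem numComponents_contract (G : Graph α β) {H : Set β} (hH : H ⊆ G.edgeSet) :
    (G.contract H).numComponents = G.numComponents := by
  have h := numComponents_contract_restrict G H (G.contract H).edgeSet
  rw [restrict_self] at h
  rw [h, contract_edgeSet, Set.sdiff_union_of_subset hH, restrict_self]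

theorem restrict_restrict_of_subset (G : Graph α β) {A B : Set β} (h : B ⊆ A) :
    (G.restrict A).restrict B = G.restrict B := by
  rw [restrict_restrict, Set.inter_eq_right.2 h]

/-- All component counts are taken in `G`, so that this sum can be multiplied with the one for the
contraction by the same set. -/
theorem tutteEval_restrict [Finite β] (G : Graph α β) {A : Finset β}
    (hA : (A : Set β) ⊆ G.edgeSet) (p q : ℤ[X]) :
    (G.restrict (A : Set β)).tutteEval p q = ∑ B ∈ A.powerset,
      (p - 1) ^ ((G.restrict (B : Set β)).numComponents -
        (G.restrict (A : Set β)).numComponents) *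
      (q - 1) ^ (B.card + (G.restrict (B : Set β)).numComponents - G.vertexSet.ncard) := by
  have h1 : (Set.toFinite (G.restrict (A : Set β)).edgeSet).toFinset = A := by
    ext x
    simpa using fun h => hA h
  rw [tutteEval_eq_sum, h1]
  refine Finset.sum_congr rfl fun B hB => ?_
  rw [restrict_restrict_of_subset G (by exact_mod_cast Finset.mem_powerset.1 hB)]
  rfl

/-- A set of edges of the contraction is indexed by its union with `A`; contracting `A` and then
keeping a set leaves the components of that union. -/
theorem tutteEval_contract [Finite β] [DecidableEq β] (G : Graph α β) {A E : Finset β}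
    (hE : (E : Set β) = G.edgeSet) (hA : A ⊆ E) (p q : ℤ[X]) :
    (G.contract (A : Set β)).tutteEval p q = ∑ B ∈ Finset.Icc A E,
      (p - 1) ^ ((G.restrict (B : Set β)).numComponents - G.numComponents) *
      (q - 1) ^ (B.card - A.card + (G.restrict (B : Set β)).numComponents -
        (G.restrict (A : Set β)).numComponents) := by
  have h1 : (Set.toFinite (G.contract (A : Set β)).edgeSet).toFinset = E \ A := by
    ext x
    simp [contract_edgeSet, ← hE]
  have hA' : (A : Set β) ⊆ G.edgeSet := by rw [← hE]; exact_mod_cast hA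
  rw [tutteEval_eq_sum, h1, Finset.Icc_eq_image_powerset hA, Finset.sum_image]
  · refine Finset.sum_congr rfl fun B hB => ?_
    have hd : Disjoint A B :=
      (Finset.disjoint_sdiff).mono_right (Finset.mem_powerset.1 hB)
    rw [numComponents_contract_restrict, numComponents_contract _ hA', Finset.coe_union,
      Set.union_comm (B : Set β), Finset.card_union_of_disjoint hd, Nat.add_sub_cancel_left]
    -- The vertices of the contraction are by definition the components of `G | A`, which is where
    -- the last subtracted term comes from.
    rfl
  · intro B hB B' hB' h
    have hd : Disjoint A B :=
      (Finset.disjoint_sdiff).mono_right (Finset.mem_powerset.1 hB)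
    have hd' : Disjoint A B' :=
      (Finset.disjoint_sdiff).mono_right (Finset.mem_powerset.1 hB')
    rw [← Finset.union_sdiff_cancel_left hd, ← Finset.union_sdiff_cancel_left hd']
    exact congrArg (· \ A) h

/-! ### Alternating sums and the convolution formula -/

/-- Factoring out the sign of `B` leaves the alternating sum over subsets of `S \ B`, which vanishes
unless `S \ B` is empty. -/
theorem sum_Icc_neg_one_pow_card [DecidableEq β] {B S : Finset β} (h : B ⊆ S) :
    ∑ A ∈ Finset.Icc B S, (-1 : ℤ[X]) ^ A.card = if B = S then (-1) ^ S.card else 0 := by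
  rw [Finset.Icc_eq_image_powerset h, Finset.sum_image]
  · have : ∀ A ∈ (S \ B).powerset, (-1 : ℤ[X]) ^ (B ∪ A).card = (-1) ^ B.card * (-1) ^ A.card := by
      intro A hA
      rw [Finset.card_union_of_disjoint
        ((Finset.disjoint_sdiff).mono_right (Finset.mem_powerset.1 hA)), pow_add]
    rw [Finset.sum_congr rfl this, ← Finset.mul_sum]
    have h2 := congrArg (Int.cast : ℤ → ℤ[X]) (Finset.sum_powerset_neg_one_pow_card (x := S \ B))
    push_cast at h2
    rw [h2]
    by_cases hBS : B = S
    · simp [hBS]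
    · have : ¬ S ⊆ B := fun h' => hBS (h.antisymm h')
      simp [hBS, this]
  · intro A hA A' hA' hAA
    have hd : Disjoint B A :=
      (Finset.disjoint_sdiff).mono_right (Finset.mem_powerset.1 hA)
    have hd' : Disjoint B A' :=
      (Finset.disjoint_sdiff).mono_right (Finset.mem_powerset.1 hA')
    rw [← Finset.union_sdiff_cancel_left hd, ← Finset.union_sdiff_cancel_left hd']
    exact congrArg (· \ B) hAA

theorem numComponents_restrict_le_of_subset [Finite α] [DecidableEq β] (G : Graph α β)
    {A B : Finset β} (h : A ⊆ B) :
    (G.restrict (B : Set β)).numComponents ≤ (G.restrict (A : Set β)).numComponents := by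
  have := numComponents_restrict_anti G (A : Set β) B
  rwa [← Finset.coe_union, Finset.union_eq_right.2 h] at this

/-- Each added edge merges at most two components. The bound keeps the nullity exponent of a
contraction from truncating. -/
theorem numComponents_restrict_le_card_add [Finite α] [DecidableEq β] (G : Graph α β)
    {A B : Finset β} (h : A ⊆ B) :
    (G.restrict (A : Set β)).numComponents ≤
      B.card - A.card + (G.restrict (B : Set β)).numComponents := by
  obtain ⟨S, rfl, hd⟩ : ∃ S, B = A ∪ S ∧ Disjoint A S :=
    ⟨B \ A, (Finset.union_sdiff_of_subset h).symm, Finset.disjoint_sdiff⟩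
  rw [Finset.card_union_of_disjoint hd, Nat.add_sub_cancel_left]
  clear h hd
  induction S using Finset.induction_on with
  | empty => simp
  | insert e S he ih =>
    rw [Finset.card_insert_of_notMem he, Finset.union_insert, Finset.coe_insert]
    have := (numComponents_restrict_insert_le G e ((A ∪ S : Finset β) : Set β)).2
    omega

/-- The convolution formula of Kook, Reiner and Stanton for the Tutte polynomial. -/
theorem tutteEval_convolution [Finite α] [Finite β] [DecidableEq β] (G : Graph α β)
    {E : Finset β} (hE : (E : Set β) = G.edgeSet) (p q : ℤ[X]) :
    G.tutteEval p q = ∑ A ∈ E.powerset,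
      (G.restrict (A : Set β)).tutteEval 0 q * (G.contract (A : Set β)).tutteEval p 0 := by
  have hE' : (Set.toFinite G.edgeSet).toFinset = E := by
    ext x
    simp [← hE]
  let k : Finset β → ℕ := fun A => (G.restrict (A : Set β)).numComponents
  let f : Finset β → ℤ[X] := fun B => (q - 1) ^ (B.card + k B - G.vertexSet.ncard)
  let g : Finset β → ℤ[X] := fun S => (p - 1) ^ (k S - G.numComponents)
  have hterm : ∀ A ∈ E.powerset,
      (G.restrict (A : Set β)).tutteEval 0 q * (G.contract (A : Set β)).tutteEval p 0 =
      ∑ B ∈ A.powerset, ∑ S ∈ Finset.Icc A E,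
        f B * g S * (-1) ^ (k B + k S + S.card) * (-1) ^ A.card := by
    intro A hA
    have hA := Finset.mem_powerset.1 hA
    rw [tutteEval_restrict G (by rw [← hE]; exact_mod_cast hA), tutteEval_contract G hE hA,
      Finset.sum_mul_sum]
    refine Finset.sum_congr rfl fun B hB => Finset.sum_congr rfl fun S hS => ?_
    have hBA := Finset.mem_powerset.1 hB
    have hAS := (Finset.mem_Icc.1 hS).1
    have h1 : k A ≤ k B := numComponents_restrict_le_of_subset G hBA
    have h2 : k A ≤ S.card - A.card + k S := numComponents_restrict_le_card_add G hAS
    have h3 := Finset.card_le_card hAS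
    -- Only parity matters: `k A` occurs twice and cancels modulo 2. By `h1`, `h2` and `h3` no
    -- subtraction truncates.
    have h4 : (-1 : ℤ[X]) ^ (k B - k A) * (-1) ^ (S.card - A.card + k S - k A) =
        (-1) ^ (k B + k S + S.card) * (-1) ^ A.card := by
      rw [← pow_add, ← pow_add, neg_one_pow_eq_pow_mod_two,
        neg_one_pow_eq_pow_mod_two (n := _ + A.card)]
      congr 1
      omega
    simp only [zero_sub]
    calc _ = f B * g S * ((-1 : ℤ[X]) ^ (k B - k A) * (-1) ^ (S.card - A.card + k S - k A)) := by
          simp only [f, g, k]; ring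
      _ = _ := by rw [h4]; ring
  rw [Finset.sum_congr rfl hterm, tutteEval_eq_sum, hE']
  -- The expanded product is a sum over chains B ⊆ A ⊆ S ⊆ E in which `A` enters only through a
  -- sign. Summing over `A` first leaves the terms with S = B, where the remaining signs cancel.
  calc _ = ∑ B ∈ E.powerset, ∑ S ∈ Finset.Icc B E, ∑ A ∈ Finset.Icc B S,
        f B * g S * (-1) ^ (k B + k S + S.card) * (-1) ^ A.card := ?_
    _ = _ := ?_
  · refine Finset.sum_congr rfl fun B hB => ?_
    have hB := Finset.mem_powerset.1 hB
    have : ∀ S ∈ Finset.Icc B E, ∑ A ∈ Finset.Icc B S,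
        f B * g S * (-1) ^ (k B + k S + S.card) * (-1 : ℤ[X]) ^ A.card =
        if B = S then f B * g B else 0 := by
      intro S hS
      rw [← Finset.mul_sum, sum_Icc_neg_one_pow_card (Finset.mem_Icc.1 hS).1]
      split_ifs with h
      · subst h
        rw [mul_assoc, ← pow_add, Even.neg_one_pow ⟨k B + B.card, by ring⟩, mul_one]
      · simp
    rw [Finset.sum_congr rfl this, Finset.sum_ite_eq, if_pos (Finset.left_mem_Icc.2 hB)]
    simp only [f, g, k]
    ring
  · rw [Finset.sum_sigma', Finset.sum_sigma', Finset.sum_sigma', Finset.sum_sigma']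
    refine Finset.sum_bij' (fun x _ => ⟨⟨x.2, x.1.1⟩, x.1.2⟩) (fun x _ => ⟨⟨x.1.2, x.2⟩, x.1.1⟩)
      ?_ ?_ ?_ ?_ ?_
    · rintro ⟨⟨B, S⟩, A⟩ h
      simp only [Finset.mem_sigma, Finset.mem_powerset, Finset.mem_Icc] at h ⊢
      exact ⟨⟨h.2.2.trans h.1.2.2, h.2.1⟩, h.2.2, h.1.2.2⟩
    · rintro ⟨⟨A, B⟩, S⟩ h
      simp only [Finset.mem_sigma, Finset.mem_powerset, Finset.mem_Icc] at h ⊢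
      exact ⟨⟨h.1.2.trans h.1.1, h.1.2.trans h.2.1, h.2.2⟩, h.1.2, h.2.1⟩
    · rintro ⟨⟨B, S⟩, A⟩ h
      rfl
    · rintro ⟨⟨A, B⟩, S⟩ h
      rfl
    · rintro ⟨⟨B, S⟩, A⟩ h
      rfl

/-- A bridge `e` makes the value of the Tutte polynomial at `x = 0` vanish. -/
theorem tutteEval_zero_left_of_isBridge [Finite α] [Finite β] (G : Graph α β) {e : β}
    (h : G.IsBridge e) (q : ℤ[X]) : G.tutteEval 0 q = 0 := by
  simp [tutteEval, tutte_of_isBridge G h]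

/-- A loop `e` makes the value of the Tutte polynomial at `y = 0` vanish. -/
theorem tutteEval_zero_right_of_isLoopAt [Finite α] [Finite β] (G : Graph α β) {e : β} {v : α}
    (h : G.IsLoopAt e v) (p : ℤ[X]) : G.tutteEval p 0 = 0 := by
  simp [tutteEval, tutte_of_isLoopAt G h]

end Graph

/-! ### Counting with fixed-point-free involutions -/

/-- Every orbit is a pair {x, g x}. For the gluing it gives twice as many edges as crossings. -/
theorem two_mul_card_sameCycle_quotient {X : Type*} [Fintype X] (g : Equiv.Perm X)
    (h2 : ∀ x, g (g x) = x) (hne : ∀ x, g x ≠ x) :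
    2 * Nat.card (Quotient (Equiv.Perm.SameCycle.setoid g)) = Nat.card X := by
  classical
  have hs : ∀ x y, g.SameCycle x y ↔ y = x ∨ y = g x := by
    intro x y
    constructor
    · rintro ⟨i, rfl⟩
      have hg : g ^ (2 : ℤ) = 1 := Equiv.ext fun z => by simpa [zpow_ofNat, pow_two] using h2 z
      obtain ⟨j, rfl | rfl⟩ := i.even_or_odd'
      · left; simp [zpow_mul, hg]
      · right; simp [zpow_add, zpow_mul, hg]
    · rintro (rfl | rfl)
      · exact .refl _ _
      · exact ⟨1, by simp⟩
  have := Fintype.ofFinite (Quotient (Equiv.Perm.SameCycle.setoid g))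
  rw [Nat.card_eq_fintype_card, Nat.card_eq_fintype_card, ← Finset.card_univ (α := X),
    Finset.card_eq_sum_card_fiberwise (f := Quotient.mk (Equiv.Perm.SameCycle.setoid g))
      (t := Finset.univ) (fun _ _ => Finset.mem_coe.2 (Finset.mem_univ _))]
  have : ∀ q ∈ (Finset.univ : Finset (Quotient (Equiv.Perm.SameCycle.setoid g))),
      (Finset.univ.filter
        fun x => Quotient.mk (Equiv.Perm.SameCycle.setoid g) x = q).card = 2 := by
    intro q _
    obtain ⟨x, rfl⟩ := Quotient.exists_rep q
    have : (Finset.univ.filter fun y => Quotient.mk (Equiv.Perm.SameCycle.setoid g) y =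
        Quotient.mk (Equiv.Perm.SameCycle.setoid g) x) = {x, g x} := by
      ext y
      simp only [Finset.mem_filter, Finset.mem_univ, true_and, Finset.mem_insert,
        Finset.mem_singleton, Quotient.eq, ← hs x y]
      exact Equiv.Perm.sameCycle_comm
    rw [this, Finset.card_pair (hne x).symm]
  rw [Finset.sum_congr rfl this]
  simp [mul_comm]

theorem Resolution.arc_arc (r : Resolution) (i : Fin 4) : r.arc (r.arc i) = i := by
  revert r i; decide

theorem Resolution.arc_ne (r : Resolution) (i : Fin 4) : r.arc i ≠ i := by
  revert r i; decide

theorem natCast_card_eq_zero_of_involution {X : Type*} (S : Finset X) (f : X → X)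
    (hS : ∀ x ∈ S, f x ∈ S) (h2 : ∀ x, f (f x) = x) (hne : ∀ x, f x ≠ x) :
    (S.card : ZMod 2) = 0 := by
  have := Finset.sum_involution (s := S) (f := fun _ => (1 : ZMod 2)) (fun x _ => f x)
    (fun _ _ => by decide) (fun x _ _ => hne x) hS (fun x _ => h2 x)
  simpa using this

/-! ### State circles at one crossing -/

namespace ConnectedLinkDiagram

variable {C : Type*} (D : ConnectedLinkDiagram C)

/-- Two ends are related when they are joined by an edge of the diagram or by an arc of a
resolved crossing other than `c`. -/
def JoinedAwayFrom (σ : D.State) (c : C) (x y : C × Fin 4) : Prop :=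
  y = D.glue x ∨ (x.1 ≠ c ∧ y = (x.1, (σ x.1).arc x.2))

/-- A walk along the state circle that leaves `c` through `(c, 0)` comes back to `c`. -/
theorem exists_eqvGen_joinedAwayFrom [Finite C] (σ : D.State) (c : C) :
    ∃ i : Fin 4, i ≠ 0 ∧ Relation.EqvGen (D.JoinedAwayFrom σ c) (c, 0) (c, i) := by
  classical
  have := Fintype.ofFinite C
  by_contra! hcon
  let S : Finset (C × Fin 4) :=
    Finset.univ.filter fun x => Relation.EqvGen (D.JoinedAwayFrom σ c) (c, 0) x
  -- Parity argument: gluing pairs off all of `S`, and the arcs pair off its ends away from `c`. So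
  -- `S` has an even number of ends at `c`, and (c, 0) cannot be the only one.
  have h1 : (S.card : ZMod 2) = 0 := by
    refine natCast_card_eq_zero_of_involution S D.glue ?_ D.glue_glue D.glue_ne
    intro x hx
    simp only [S, Finset.mem_filter, Finset.mem_univ, true_and] at hx ⊢
    exact hx.trans _ _ _ (.rel _ _ (Or.inl rfl))
  have h2 : ((S.filter fun x => x.1 ≠ c).card : ZMod 2) = 0 := by
    refine natCast_card_eq_zero_of_involution _ (fun x => (x.1, (σ x.1).arc x.2)) ?_ ?_ ?_
    · intro x hx
      simp only [S, Finset.mem_filter, Finset.mem_univ, true_and] at hx ⊢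
      exact ⟨hx.1.trans _ _ _ (.rel _ _ (Or.inr ⟨hx.2, rfl⟩)), hx.2⟩
    · exact fun x => Prod.ext rfl (Resolution.arc_arc _ _)
    · exact fun x h => Resolution.arc_ne _ _ (congrArg Prod.snd h)
  have h3 : (S.filter fun x => ¬ x.1 ≠ c) = {(c, 0)} := by
    ext ⟨d, i⟩
    simp only [S, Finset.mem_filter, Finset.mem_univ, true_and, not_not, Finset.mem_singleton,
      Prod.mk.injEq]
    constructor
    · rintro ⟨h, rfl⟩
      exact ⟨rfl, by_contra fun hi => hcon i hi h⟩
    · rintro ⟨rfl, rfl⟩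
      exact ⟨.refl _, rfl⟩
  have h4 := Finset.card_filter_add_card_filter_not (s := S) (fun x => x.1 ≠ c)
  rw [h3, Finset.card_singleton] at h4
  rw [← h4] at h1
  push_cast at h1
  rw [h2] at h1
  exact absurd h1 (by decide)

theorem stateCircle_eq_of_joinedAwayFrom [DecidableEq C] (σ : D.State) (c : C) (r : Resolution)
    {i j : Fin 4} (h : Relation.EqvGen (D.JoinedAwayFrom σ c) (c, i) (c, j)) :
    D.stateCircle (Function.update σ c r) c i = D.stateCircle (Function.update σ c r) c j := by
  refine Quotient.sound (h.mono ?_)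
  rintro x y (rfl | ⟨hx, rfl⟩)
  · exact Or.inl rfl
  · right
    rw [Function.update_of_ne hx]

theorem stateCircle_arc (σ : D.State) (c : C) (i : Fin 4) :
    D.stateCircle σ c ((σ c).arc i) = D.stateCircle σ c i :=
  (Quotient.sound (.rel _ _ (Or.inr rfl) : D.circleSetoid σ (c, i) (c, (σ c).arc i))).symm

/-- For one of the two resolutions of `c`, the segment at `c` joins a circle to itself. -/
theorem exists_stateCircle_update_eq [Finite C] [DecidableEq C] (σ : D.State) (c : C) :
    ∃ r, D.stateCircle (Function.update σ c r) c 0 =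
      D.stateCircle (Function.update σ c r) c 2 := by
  obtain ⟨i, hi, h⟩ := D.exists_eqvGen_joinedAwayFrom σ c
  have key : ∀ r, D.stateCircle (Function.update σ c r) c 0 =
      D.stateCircle (Function.update σ c r) c i := fun r =>
    D.stateCircle_eq_of_joinedAwayFrom σ c r h
  have harc : ∀ r j, D.stateCircle (Function.update σ c r) c (r.arc j) =
      D.stateCircle (Function.update σ c r) c j := by
    intro r j
    have := D.stateCircle_arc (Function.update σ c r) c j
    rwa [Function.update_self] at this
  have hi' : i = 1 ∨ i = 2 ∨ i = 3 := by clear key h; revert i; decide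
  -- The walk from end 0 returns at `i`. The B-arc continues from 1 to 2 and the A-arc from 3 to 2;
  -- if `i` is 2, either resolution would do.
  rcases hi' with rfl | rfl | rfl
  · exact ⟨.B, (key .B).trans (harc .B 1).symm⟩
  · exact ⟨.A, key .A⟩
  · exact ⟨.A, (key .A).trans (harc .A 3).symm⟩

/-! ### Regions along edges and state circles -/

/-- One step of `walkFace` stays in its orbit: both corners lie on the same side of one edge. The
primed version is the other side. -/
theorem region_glue (x : C × Fin 4) :
    D.region (D.glue x).1 ((D.glue x).2 - 1) = D.region x.1 x.2 :=
  (Quotient.sound (s := Equiv.Perm.SameCycle.setoid (walkFace D.glue))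
    (⟨1, by rw [zpow_one]; rfl⟩ : (walkFace D.glue).SameCycle x
      ((D.glue x).1, (D.glue x).2 - 1))).symm

theorem region_glue' (x : C × Fin 4) :
    D.region (D.glue x).1 (D.glue x).2 = D.region x.1 (x.2 - 1) := by
  have := D.region_glue (D.glue x)
  rw [D.glue_glue] at this
  exact this.symm

instance [Finite C] : Finite D.Region := inferInstanceAs (Finite (Quotient _))

namespace Coloring

variable {D} (κ : D.Coloring)

theorem isBlack_sub_one (c : C) (i : Fin 4) :
    κ.IsBlack (D.region c (i - 1)) ↔ ¬ κ.IsBlack (D.region c i) := by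
  have := κ.alternating c (i - 1)
  rw [sub_add_cancel] at this
  tauto

/-- The coloring with black and white exchanged. -/
def compl : D.Coloring where
  IsBlack r := ¬ κ.IsBlack r
  alternating c i := not_congr (κ.alternating c i)

theorem isPositive_compl (c : C) : κ.compl.IsPositive c ↔ ¬ κ.IsPositive c := Iff.rfl

/-- Exchanging the colors changes every sign but no resolution. Hence a state that selects A in the
Tait graph selects the complement of A in its dual. -/
theorem edgesOf_compl (σ : D.State) : κ.compl.edgesOf σ = (κ.edgesOf σ)ᶜ := by
  ext c
  simp only [edgesOf, Set.mem_union, Set.mem_ofPred_eq, Set.mem_compl_iff, isPositive_compl]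
  by_cases h : κ.IsPositive c <;> cases σ c <;> simp [h]

theorem edgeSet_taitGraph : κ.taitGraph.edgeSet = Set.univ := by
  refine Set.eq_univ_of_forall fun c => ?_
  by_cases h : κ.IsBlack (D.region c 0)
  · exact Graph.IsLink.edge_mem (⟨0, h, rfl, rfl⟩ : κ.taitGraph.IsLink c _ _)
  · exact Graph.IsLink.edge_mem
      (⟨1, (κ.alternating c 0).2 h, rfl, rfl⟩ : κ.taitGraph.IsLink c _ _)

open Classical in
/-- The black region at an end of a strand. -/
noncomputable def blackRegion (x : C × Fin 4) : D.Region :=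
  if κ.IsBlack (D.region x.1 x.2) then D.region x.1 x.2 else D.region x.1 (x.2 - 1)

theorem blackRegion_of_isBlack {c : C} {i : Fin 4} (h : κ.IsBlack (D.region c i)) :
    κ.blackRegion (c, i) = D.region c i := if_pos h

theorem blackRegion_of_not_isBlack {c : C} {i : Fin 4} (h : ¬ κ.IsBlack (D.region c i)) :
    κ.blackRegion (c, i) = D.region c (i - 1) := if_neg h

theorem isBlack_blackRegion (x : C × Fin 4) : κ.IsBlack (κ.blackRegion x) := by
  obtain ⟨c, i⟩ := x
  by_cases h : κ.IsBlack (D.region c i)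
  · rwa [κ.blackRegion_of_isBlack h]
  · rw [κ.blackRegion_of_not_isBlack h]
    exact (κ.isBlack_sub_one c i).2 h

/-- Exactly one side of an edge is black, and it is seen from both ends. -/
theorem blackRegion_glue (x : C × Fin 4) : κ.blackRegion (D.glue x) = κ.blackRegion x := by
  have h1 := κ.isBlack_sub_one (D.glue x).1 (D.glue x).2
  rw [D.region_glue] at h1
  by_cases h : κ.IsBlack (D.region x.1 x.2)
  · rw [blackRegion, if_neg (h1.1 h), blackRegion, if_pos h, D.region_glue]
  · rw [blackRegion, if_pos (by tauto), blackRegion, if_neg h, D.region_glue']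

/-- The black regions at two ends of a crossing `c` are equal or joined by the edge `c`. -/
theorem blackRegion_eq_or_isLink (c : C) (i j : Fin 4) :
    κ.blackRegion (c, i) = κ.blackRegion (c, j) ∨
      κ.taitGraph.IsLink c (κ.blackRegion (c, i)) (κ.blackRegion (c, j)) := by
  have h : ∀ i, ∃ k, κ.IsBlack (D.region c k) ∧ κ.blackRegion (c, i) = D.region c k := by
    intro i
    by_cases h : κ.IsBlack (D.region c i)
    · exact ⟨i, h, κ.blackRegion_of_isBlack h⟩
    · exact ⟨i - 1, (κ.isBlack_sub_one c i).2 h, κ.blackRegion_of_not_isBlack h⟩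
  obtain ⟨k, hk, hk'⟩ := h i
  obtain ⟨l, hl, hl'⟩ := h j
  rw [hk', hl']
  have hkl : l = k ∨ l = k + 1 ∨ k = l + 1 ∨ l = k + 2 := by
    have : ∀ k l : Fin 4, l = k ∨ l = k + 1 ∨ k = l + 1 ∨ l = k + 2 := by decide
    exact this k l
  rcases hkl with rfl | rfl | rfl | rfl
  · exact Or.inl rfl
  · exact absurd hk ((κ.alternating c k).1 hl)
  · exact absurd hl ((κ.alternating c l).1 hk)
  · exact Or.inr ⟨k, hk, rfl, rfl⟩

/-- Outside E_σ the resolution separates the two black corners, so each arc runs along a single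
black corner. -/
theorem blackRegion_arc_of_notMem {σ : D.State} {c : C} (hc : c ∉ κ.edgesOf σ) (i : Fin 4) :
    κ.blackRegion (c, (σ c).arc i) = κ.blackRegion (c, i) := by
  have h0 := κ.isBlack_sub_one c 1
  have h1 := κ.alternating c 1
  have h2 := κ.alternating c 2
  simp only [edgesOf, IsPositive, Set.mem_union, Set.mem_ofPred_eq, not_or, not_and] at hc
  simp only [sub_self, show (1 : Fin 4) + 1 = 2 from rfl, show (2 : Fin 4) + 1 = 3 from rfl]
    at h0 h1 h2
  cases hσ : σ c <;>
    simp only [hσ, reduceCtorEq, imp_false, not_true_eq_false, implies_true, true_and, and_true,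
      not_not, not_false_eq_true] at hc <;>
    fin_cases i <;>
    simp [Resolution.arc, blackRegion, hc, h0, h1, h2,
      show (0 : Fin 4) - 1 = 3 from rfl,
      show (2 : Fin 4) - 1 = 1 from rfl, show (3 : Fin 4) - 1 = 2 from rfl]

/-- The black regions along a state circle lie in one component of `G | E_σ`. -/
theorem eqvGen_blackRegion (σ : D.State) {x y : C × Fin 4} (h : D.circleSetoid σ x y) :
    Relation.EqvGen (κ.taitGraph.restrict (κ.edgesOf σ)).Adj
      (κ.blackRegion x) (κ.blackRegion y) := by
  rw [← Graph.mk_eq_iff]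
  refine Graph.eqvGen_of_le (fun x => Quotient.mk
    (κ.taitGraph.restrict (κ.edgesOf σ)).componentSetoid (κ.blackRegion x)) ?_ h
  rintro x _ (rfl | rfl)
  · simp only [κ.blackRegion_glue]
  · obtain ⟨c, i⟩ := x
    -- For `c` in E_σ the arc may lead to the opposite black corner, but then the edge `c` itself
    -- connects the two.
    by_cases hc : c ∈ κ.edgesOf σ
    · obtain h | h := κ.blackRegion_eq_or_isLink c i ((σ c).arc i)
      · exact congrArg _ h
      · exact (Graph.mk_eq_iff _ _ _).2 (.rel _ _ ⟨c, hc, h⟩)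
    · exact congrArg _ (κ.blackRegion_arc_of_notMem hc i).symm

theorem isLink_blackRegion (c : C) :
    κ.taitGraph.IsLink c (κ.blackRegion (c, 0)) (κ.blackRegion (c, 2)) := by
  by_cases h : κ.IsBlack (D.region c 0)
  · rw [κ.blackRegion_of_isBlack h, κ.blackRegion_of_isBlack (i := 2) ((κ.add_two c 0).2 h)]
    exact ⟨0, h, rfl, rfl⟩
  · rw [κ.blackRegion_of_not_isBlack h,
      κ.blackRegion_of_not_isBlack (i := 2) (mt (κ.add_two c 0).1 h)]
    exact ⟨0 - 1, (κ.isBlack_sub_one c 0).2 h, rfl, rfl⟩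

/-- The Tait graph is connected. -/
theorem numComponents_taitGraph : κ.taitGraph.numComponents = 1 := by
  let m := Quotient.mk κ.taitGraph.componentSetoid
  have hc : ∀ c i j, m (κ.blackRegion (c, i)) = m (κ.blackRegion (c, j)) := by
    intro c i j
    obtain h | h := κ.blackRegion_eq_or_isLink c i j
    · exact congrArg _ h
    · exact (Graph.mk_eq_iff _ _ _).2 (.rel _ _ ⟨c, h⟩)
  have hglue : ∀ c i, m (κ.blackRegion (c, 0)) = m (κ.blackRegion ((D.glue (c, i)).1, 0)) := by
    intro c i
    rw [hc c 0 i, ← κ.blackRegion_glue]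
    exact hc _ _ _
  have hadj : ∀ c d, m (κ.blackRegion (c, 0)) = m (κ.blackRegion (d, 0)) := by
    intro c d
    obtain ⟨w⟩ := D.connected.preconnected c d
    induction w with
    | nil => rfl
    | cons h _ ih =>
      refine Eq.trans ?_ ih
      rw [SimpleGraph.fromRel_adj] at h
      obtain ⟨-, ⟨i, rfl⟩ | ⟨i, rfl⟩⟩ := h
      · exact hglue _ _
      · exact (hglue _ _).symm
  obtain ⟨c⟩ := D.connected.nonempty
  refine Set.ncard_eq_one.2 ⟨m (κ.blackRegion (c, 0)), ?_⟩
  ext q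
  constructor
  · rintro ⟨r, hr, rfl⟩
    obtain ⟨⟨d, i⟩, rfl⟩ := Quotient.exists_rep r
    have : κ.blackRegion (d, i) = D.region d i := κ.blackRegion_of_isBlack hr
    change m (D.region d i) = _
    rw [← this, hc d i 0, hadj d c]
  · rintro rfl
    exact ⟨_, κ.isBlack_blackRegion _, rfl⟩

/-- Euler's formula in terms of the black and the white regions. -/
theorem ncard_vertexSet_add_compl [Fintype C] :
    κ.taitGraph.vertexSet.ncard + κ.compl.taitGraph.vertexSet.ncard = Fintype.card C + 2 := by
  have h1 : κ.compl.taitGraph.vertexSet = κ.taitGraph.vertexSetᶜ := rfl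
  have h2 := two_mul_card_sameCycle_quotient D.glue D.glue_glue D.glue_ne
  have h3 := D.planar
  rw [h1, Set.ncard_add_ncard_compl]
  change Nat.card (Quotient (Equiv.Perm.SameCycle.setoid (walkFace D.glue))) = _
  simp only [Nat.card_eq_fintype_card (α := C × Fin 4), Fintype.card_prod, Fintype.card_fin] at h2
  rw [Nat.card_eq_fintype_card (α := C)] at h3
  omega

/-! ### States as edge sets -/

open Classical in
/-- The state whose set of edges is `A`. -/
noncomputable def stateOf (A : Set C) : D.State := fun c =>
  if c ∈ A ↔ κ.IsPositive c then .A else .B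

theorem mem_edgesOf_iff {σ : D.State} {c : C} :
    c ∈ κ.edgesOf σ ↔ (κ.IsPositive c ↔ σ c = .A) := by
  simp only [edgesOf, Set.mem_union, Set.mem_ofPred_eq]
  by_cases h : κ.IsPositive c <;> cases σ c <;> simp [h]

theorem edgesOf_stateOf (A : Set C) : κ.edgesOf (κ.stateOf A) = A := by
  ext c
  rw [mem_edgesOf_iff, stateOf]
  by_cases h : κ.IsPositive c <;> by_cases hA : c ∈ A <;> simp [h, hA]

theorem stateOf_edgesOf (σ : D.State) : κ.stateOf (κ.edgesOf σ) = σ := by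
  funext c
  rw [stateOf, mem_edgesOf_iff]
  by_cases h : κ.IsPositive c <;> cases σ c <;> simp [h]

/-- The alternative spares the identification of the resolution that puts `c` into the edge set,
which depends on its sign. -/
theorem edgesOf_update [DecidableEq C] (σ : D.State) (c : C) (r : Resolution) :
    κ.edgesOf (Function.update σ c r) = insert c (κ.edgesOf σ) ∨
      κ.edgesOf (Function.update σ c r) = κ.edgesOf σ \ {c} := by
  have h : ∀ d, d ≠ c → (d ∈ κ.edgesOf (Function.update σ c r) ↔ d ∈ κ.edgesOf σ) := by
    intro d hd
    rw [mem_edgesOf_iff, mem_edgesOf_iff, Function.update_of_ne hd]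
  by_cases hc : c ∈ κ.edgesOf (Function.update σ c r)
  · left
    ext d
    by_cases hd : d = c
    · simp [hd, hc]
    · simp [hd, h d hd]
  · right
    ext d
    by_cases hd : d = c
    · simp [hd, hc]
    · simp [hd, h d hd]

/-! ### Planar duality -/

/-- Inserting an edge `c` into `A`: either the ends of `c` are already connected in `G | A`, or
the ends of the dual edge stay connected when the dual edges of `A` and `c` are deleted. -/
theorem numComponents_insert_or_compl [Finite C] {A : Set C} {c : C} (hc : c ∉ A) :
    (κ.taitGraph.restrict (insert c A)).numComponents = (κ.taitGraph.restrict A).numComponents ∨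
    (κ.compl.taitGraph.restrict Aᶜ).numComponents =
      (κ.compl.taitGraph.restrict (insert c A)ᶜ).numComponents := by
  classical
  obtain ⟨r, hr⟩ := D.exists_stateCircle_update_eq (κ.stateOf A) c
  have hr' := Quotient.exact hr
  have h1 := Graph.numComponents_restrict_insert_of_eqv _ _ (κ.isLink_blackRegion c)
    (κ.eqvGen_blackRegion _ hr')
  have h2 := Graph.numComponents_restrict_insert_of_eqv _ _ (κ.compl.isLink_blackRegion c)
    (κ.compl.eqvGen_blackRegion _ hr')
  rw [edgesOf_compl] at h2
  -- With the resolution `r` both the ends of `c` and those of its dual edge are connected. When `c`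
  -- is in the new edge set only the dual statement has content; otherwise only the primal one does.
  obtain h | h := κ.edgesOf_update (κ.stateOf A) c r <;> rw [edgesOf_stateOf] at h <;>
    rw [h] at h1 h2
  · right
    rw [← h2]
    congr 2
    ext d
    by_cases hd : d = c <;> simp [hd, hc]
  · left
    rw [Set.sdiff_singleton_eq_self hc] at h1
    exact h1

/-- The difference of the nullity of `A` in `G` and the number of components of the complement
of `A` in the dual graph (up to a constant). Planar duality says that it is constant. -/
noncomputable def nullityDefect (A : Finset C) : ℤ :=
  (κ.taitGraph.restrict (A : Set C)).numComponents -
    (κ.compl.taitGraph.restrict (A : Set C)ᶜ).numComponents + A.card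

/-- The primal count drops by at most one, the dual count grows by at most one, and the cardinality
grows by one. A decrease would need both changes at once, which `numComponents_insert_or_compl`
excludes. -/
theorem nullityDefect_le_insert [Finite C] [DecidableEq C] {A : Finset C} {c : C} (hc : c ∉ A) :
    κ.nullityDefect A ≤ κ.nullityDefect (insert c A) := by
  have h1 := (Graph.numComponents_restrict_insert_le κ.taitGraph c (A : Set C)).2
  have h2 := (Graph.numComponents_restrict_insert_le κ.compl.taitGraph c
    ((insert c A : Finset C) : Set C)ᶜ).2
  have h3 : insert c ((insert c A : Finset C) : Set C)ᶜ = (A : Set C)ᶜ := by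
    ext d
    by_cases hd : d = c <;> simp [hd, hc]
  rw [h3] at h2
  have h4 := κ.numComponents_insert_or_compl (A := (A : Set C)) (c := c) (by simpa using hc)
  unfold nullityDefect
  rw [Finset.card_insert_of_notMem hc]
  rw [Finset.coe_insert] at *
  rcases h4 with h4 | h4 <;> push_cast <;> omega

theorem nullityDefect_mono [Finite C] [DecidableEq C] {A B : Finset C} (h : A ⊆ B) :
    κ.nullityDefect A ≤ κ.nullityDefect B := by
  rw [← Finset.union_sdiff_of_subset h]
  generalize B \ A = S
  induction S using Finset.induction_on with
  | empty => simp
  | insert e S he ih =>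
    rw [Finset.union_insert]
    by_cases heA : e ∈ A ∪ S
    · rwa [Finset.insert_eq_of_mem heA]
    · exact ih.trans (κ.nullityDefect_le_insert heA)

theorem nullityDefect_eq [Fintype C] [DecidableEq C] (A B : Finset C) :
    κ.nullityDefect A = κ.nullityDefect B := by
  have hE := κ.ncard_vertexSet_add_compl
  have hV : ∀ κ : D.Coloring,
      (κ.taitGraph.restrict ∅).numComponents = κ.taitGraph.vertexSet.ncard := fun κ =>
    Graph.numComponents_of_edgeSet_eq_empty _ (by simp)
  have hU : ∀ κ : D.Coloring, (κ.taitGraph.restrict Set.univ).numComponents = 1 := fun κ => by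
    rw [← κ.edgeSet_taitGraph, Graph.restrict_self, κ.numComponents_taitGraph]
  -- Both Tait graphs are connected, so the values are |V| - 1 and |C| + 1 - |V*|; they agree by
  -- Euler's formula.
  have h : κ.nullityDefect ∅ = κ.nullityDefect Finset.univ := by
    unfold nullityDefect
    rw [Finset.coe_empty, Finset.coe_univ, Set.compl_empty, Set.compl_univ, hV, hV, hU, hU,
      Finset.card_empty, Finset.card_univ]
    push_cast
    omega
  have key : ∀ A, κ.nullityDefect A = κ.nullityDefect ∅ := fun A =>
    le_antisymm (h ▸ κ.nullityDefect_mono (Finset.subset_univ A))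
      (κ.nullityDefect_mono (Finset.empty_subset A))
  rw [key A, key B]

/-! ### Vanishing for inadequate states -/

/-- If the segment at `c` joins a state circle to itself and `c` belongs to `E_σ`, then `c` is a
bridge of `G | E_σ`. -/
theorem isBridge_of_stateCircle_eq [Finite C] {σ : D.State} {c : C} (hc : c ∈ κ.edgesOf σ)
    (h : D.stateCircle σ c 0 = D.stateCircle σ c 2) :
    (κ.taitGraph.restrict (κ.edgesOf σ)).IsBridge c := by
  classical
  have := Fintype.ofFinite C
  have h1 := Graph.numComponents_restrict_insert_of_eqv _ _ (κ.compl.isLink_blackRegion c)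
    (κ.compl.eqvGen_blackRegion _ (Quotient.exact h))
  rw [edgesOf_compl] at h1
  refine ⟨by simp [edgeSet_taitGraph, hc], ?_⟩
  obtain ⟨A, hcA, hA⟩ : ∃ A : Finset C, c ∉ A ∧ κ.edgesOf σ = insert c (A : Set C) :=
    ⟨(κ.edgesOf σ \ {c}).toFinset, by simp, by simp [Set.insert_eq_of_mem hc]⟩
  have h2 : insert c (κ.edgesOf σ)ᶜ = (A : Set C)ᶜ := by
    ext d
    by_cases hd : d = c <;> simp [hd, hcA, hA]
  -- Here `A` is E_σ without `c`. By `h1` the dual counts for `A` and E_σ agree, so constancy of the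
  -- defect forces one more component in `G | A` than in `G | E_σ`.
  have h3 := κ.nullityDefect_eq A (insert c A)
  unfold nullityDefect at h3
  rw [Finset.coe_insert, ← hA, ← h2, h1, Finset.card_insert_of_notMem hcA] at h3
  rw [← Graph.numComponents_restrict_edgeSet_diff,
    Graph.restrict_restrict_of_subset _ (by simp [edgeSet_taitGraph])]
  have h4 : (κ.taitGraph.restrict (κ.edgesOf σ)).edgeSet \ {c} = A := by
    ext d
    by_cases hd : d = c <;> simp [hd, hcA, hA, edgeSet_taitGraph]
  rw [h4]
  push_cast at h3
  omega

/-- If the segment at `c` joins a state circle to itself and `c` does not belong to `E_σ`, then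
`c` is a loop of `G / E_σ`. -/
theorem exists_isLoopAt_of_stateCircle_eq {σ : D.State} {c : C} (hc : c ∉ κ.edgesOf σ)
    (h : D.stateCircle σ c 0 = D.stateCircle σ c 2) :
    ∃ v, (κ.taitGraph.contract (κ.edgesOf σ)).IsLoopAt c v := by
  have h1 := (Graph.mk_eq_iff _ _ _).2 (κ.eqvGen_blackRegion _ (Quotient.exact h))
  exact ⟨_, ⟨_, _, κ.isLink_blackRegion c, rfl, h1.symm⟩, hc⟩

theorem phi_eq_zero [Finite C] {σ : D.State} (h : ¬ D.IsAdequate σ) : κ.phi σ = 0 := by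
  simp only [IsAdequate, not_forall, not_not] at h
  obtain ⟨c, h⟩ := h
  by_cases hc : c ∈ κ.edgesOf σ
  · rw [phi, Graph.tutteEval_zero_left_of_isBridge _ (κ.isBridge_of_stateCircle_eq hc h),
      zero_mul]
  · obtain ⟨v, hv⟩ := κ.exists_isLoopAt_of_stateCircle_eq hc h
    rw [phi, Graph.tutteEval_zero_right_of_isLoopAt _ hv, mul_zero]

end Coloring

end ConnectedLinkDiagram

theorem theorem1p3 {C : Type*} [Fintype C] [DecidableEq C] (D : ConnectedLinkDiagram C)
    [DecidablePred D.IsAdequate] (κ : D.Coloring) :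
    κ.taitGraph.symmTutte = ∑ σ : D.State with D.IsAdequate σ, κ.phi σ := by
  classical
  -- Inadequate states contribute zero, so the sum may run over all states, which correspond to all
  -- edge sets.
  rw [Finset.sum_filter_of_ne fun σ _ h => not_not.1 (mt κ.phi_eq_zero h), Graph.symmTutte,
    Graph.tutteEval_convolution κ.taitGraph (E := Finset.univ)
      (by rw [κ.edgeSet_taitGraph, Finset.coe_univ])]
  refine Finset.sum_bij' (fun A _ => κ.stateOf (A : Set C)) (fun σ _ => (κ.edgesOf σ).toFinset)
    (fun _ _ => Finset.mem_univ _) (fun _ _ => by simp) ?_ ?_ ?_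
  · intro A _
    simp [κ.edgesOf_stateOf]
  · intro σ _
    simp [κ.stateOf_edgesOf]
  · intro A _
    rw [ConnectedLinkDiagram.Coloring.phi, κ.edgesOf_stateOf]
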